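/- Let $\mathrm{Prop}$ be a countably infinite set of atoms and let $A$ be a finite nonempty set of $n$ agents. Formulas are given by $$\phi ::= \bot \mid \top \mid p \mid \neg p \mid (\phi\wedge\phi) \mid (\phi\vee\phi) \mid \Box_a\phi \mid \Diamond_a\phi \qquad (p\in\mathrm{Prop},\ a\in A);$$ negation is extended to all formulas by the De Morgan dualities ($\neg\bot=\top$, $\neg\neg p=p$, $\neg\Box_a\phi=\Diamond_a\neg\phi$, etc.), and $\phi\to\psi$ abbreviates $\neg\phi\vee\psi$. Let $\mathrm{Var}^+(\phi)$ (resp. $\mathrm{Var}^-(\phi)$) be the set of atoms $p$ such that the literal $p$ (resp. $\neg p$) occurs in $\phi$, where an occurrence of $p$ inside a literal $\neg p$ does not count as an occurrence of the literal $p$; let $\mathrm{Var}(\phi)=\mathrm{Var}^+(\phi)\cup\mathrm{Var}^-(\phi)$, and let $\mathrm{Ag}(\phi)$ be the set of agents $a$ such that $\Box_a$ or $\Diamond_a$ occurs in $\phi$. Let $\mathsf{S5}_n$ be the set of formulas that are true at all worlds of all Kripke models $(W,(R_a)_{a\in A},V)$ with $W\neq\varnothing$ in which every $R_a$ is an equivalence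 relation on $W$. Then $\mathsf{S5}_n$ has the agent Lyndon interpolation property: for all formulas $\phi,\psi$ with $\phi\to\psi\in\mathsf{S5}_n$ there is a formula $\delta$ such that $\phi\to\delta\in\mathsf{S5}_n$, $\delta\to\psi\in\mathsf{S5}_n$, and $$\mathrm{Var}^{*}(\delta)\subseteq\mathrm{Var}^{*}(\phi)\cap\mathrm{Var}^{*}(\psi)\ \text{ for each } *\in\{+,-\},\qquad \mathrm{Ag}(\delta)\subseteq\mathrm{Ag}(\phi)\cap\mathrm{Ag}(\psi).$$ Consequently, $\mathsf{S5}_n$ also has the Lyndon interpolation property (the same without the condition on agents), the Craig interpolation property for atoms and agents (with $\mathrm{Var}$ in place of $\mathrm{Var}^{+}$ and $\mathrm{Var}^-$), and the Craig interpolation property (with $\mathrm{Var}$ in place of $\mathrm{Var}^{\pm}$ and without the condition on agents). -/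

import Mathlib

universe u v w

namespace EpistemicLogic

/-- Multi-agent modal formulas in negation normal form, over atoms `P` and agents `A`. -/
inductive Formula (P : Type u) (A : Type v) : Type (max u v)
  | bot : Formula P A
  | top : Formula P A
  | atom (p : P) : Formula P A
  | natom (p : P) : Formula P A
  | and (φ ψ : Formula P A) : Formula P A
  | or (φ ψ : Formula P A) : Formula P A
  | box (a : A) (φ : Formula P A) : Formula P A
  | dia (a : A) (φ : Formula P A) : Formula P A

namespace Formula

variable {P : Type u} {A : Type v}

/-- Negation of an arbitrary formula, by the De Morgan dualities. -/
def neg : Formula P A → Formula P A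
  | bot => top
  | top => bot
  | atom p => natom p
  | natom p => atom p
  | and φ ψ => or φ.neg ψ.neg
  | or φ ψ => and φ.neg ψ.neg
  | box a φ => dia a φ.neg
  | dia a φ => box a φ.neg

/-- Implication `φ → ψ`, which abbreviates `¬φ ∨ ψ`. -/
def imp (φ ψ : Formula P A) : Formula P A := or φ.neg ψ

/-- The variables that occur positively. -/
def posVar : Formula P A → Set P
  | bot => ∅
  | top => ∅
  | atom p => {p}
  | natom _ => ∅
  | and φ ψ => φ.posVar ∪ ψ.posVar
  | or φ ψ => φ.posVar ∪ ψ.posVar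
  | box _ φ => φ.posVar
  | dia _ φ => φ.posVar

/-- The variables that occur negatively. -/
def negVar : Formula P A → Set P
  | bot => ∅
  | top => ∅
  | atom _ => ∅
  | natom p => {p}
  | and φ ψ => φ.negVar ∪ ψ.negVar
  | or φ ψ => φ.negVar ∪ ψ.negVar
  | box _ φ => φ.negVar
  | dia _ φ => φ.negVar

/-- All variables that occur in a formula. -/
def var (φ : Formula P A) : Set P := φ.posVar ∪ φ.negVar

/-- The agents that occur in a formula. -/
def ag : Formula P A → Set A
  | bot => ∅
  | top => ∅
  | atom _ => ∅
  | natom _ => ∅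
  | and φ ψ => φ.ag ∪ ψ.ag
  | or φ ψ => φ.ag ∪ ψ.ag
  | box a φ => {a} ∪ φ.ag
  | dia a φ => {a} ∪ φ.ag

end Formula

/-- Epistemic Kripke models: every agent's accessibility relation is an equivalence relation. -/
structure Model (P : Type u) (A : Type v) where
  /-- The worlds. -/
  World : Type w
  /-- There is at least one world. -/
  nonempty : Nonempty World
  /-- The accessibility relation of each agent. -/
  R : A → World → World → Prop
  /-- The accessibility relations are equivalence relations. -/
  equiv : ∀ a, Equivalence (R a)
  /-- The valuation: the set of worlds where an atom is true. -/
  V : P → Set World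

/-- Truth of a formula in a world of a model. -/
def Model.Sat {P : Type u} {A : Type v} (M : Model.{u, v, w} P A) :
    M.World → Formula P A → Prop
  | _, .bot => False
  | _, .top => True
  | x, .atom p => x ∈ M.V p
  | x, .natom p => x ∉ M.V p
  | x, .and φ ψ => M.Sat x φ ∧ M.Sat x ψ
  | x, .or φ ψ => M.Sat x φ ∨ M.Sat x ψ
  | x, .box a φ => ∀ y, M.R a x y → M.Sat y φ
  | x, .dia a φ => ∃ y, M.R a x y ∧ M.Sat y φ

/-- The multi-agent logic `S5`: the formulas true in all worlds of all epistemic models. -/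
def S5 (P : Type u) (A : Type v) : Set (Formula P A) :=
  {φ | ∀ (M : Model.{u, v, w} P A) (x : M.World), M.Sat x φ}

section Interpolation

variable {P : Type u} {A : Type v}

/-- Craig interpolation property, for variables. -/
def HasCIP (L : Set (Formula P A)) : Prop :=
  ∀ φ ψ : Formula P A, φ.imp ψ ∈ L →
    ∃ δ : Formula P A, φ.imp δ ∈ L ∧ δ.imp ψ ∈ L ∧
      δ.var ⊆ φ.var ∩ ψ.var

/-- Lyndon interpolation property, for variables. -/
def HasLIP (L : Set (Formula P A)) : Prop :=
  ∀ φ ψ : Formula P A, φ.imp ψ ∈ L →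
    ∃ δ : Formula P A, φ.imp δ ∈ L ∧ δ.imp ψ ∈ L ∧
      δ.posVar ⊆ φ.posVar ∩ ψ.posVar ∧
      δ.negVar ⊆ φ.negVar ∩ ψ.negVar

/-- Craig interpolation property, for variables and agents simultaneously. -/
def HasAgentCIP (L : Set (Formula P A)) : Prop :=
  ∀ φ ψ : Formula P A, φ.imp ψ ∈ L →
    ∃ δ : Formula P A, φ.imp δ ∈ L ∧ δ.imp ψ ∈ L ∧
      δ.var ⊆ φ.var ∩ ψ.var ∧
      δ.ag ⊆ φ.ag ∩ ψ.ag

/-- Agent Lyndon interpolation property. -/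
def HasALIP (L : Set (Formula P A)) : Prop :=
  ∀ φ ψ : Formula P A, φ.imp ψ ∈ L →
    ∃ δ : Formula P A, φ.imp δ ∈ L ∧ δ.imp ψ ∈ L ∧
      δ.posVar ⊆ φ.posVar ∩ ψ.posVar ∧
      δ.negVar ⊆ φ.negVar ∩ ψ.negVar ∧
      δ.ag ⊆ φ.ag ∩ ψ.ag

end Interpolation

end EpistemicLogic

/-! Take `θ = ¬ψ`. The type of a world is the finite set of subformulas of `φ` (or of `θ`) true
there. If an interpolant exists for each pair of types, one containing `φ` and one containing `θ`,
these finitely many combine into an interpolant for `φ → ψ` (`separated_of_forall`). Otherwise some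
such pair is inseparable. All inseparable pairs form a finite model in which `a` relates pairs whose
coordinates both agree on the formulas `□_a`, `◇_a`; this is an equivalence whatever the types are.
Inseparability supplies consistent literals (`Inseparable.atom_notMem`) and diamond witnesses
(`Inseparable.exists_of_dia_mem`), so each pair satisfies both its types
(`Inseparable.exists_model`). Then `φ` and `¬ψ` hold at one world, against validity. -/

namespace EpistemicLogic

/-! ### Subformulas and vocabulary -/

namespace Formula

variable {P : Type u} {A : Type v}

/-- The set of subformulas of a formula. -/
def sub : Formula P A → Set (Formula P A)
  | bot => {bot}
  | top => {top}
  | atom p => {atom p}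
  | natom p => {natom p}
  | and φ ψ => {and φ ψ} ∪ (φ.sub ∪ ψ.sub)
  | or φ ψ => {or φ ψ} ∪ (φ.sub ∪ ψ.sub)
  | box a φ => {box a φ} ∪ φ.sub
  | dia a φ => {dia a φ} ∪ φ.sub

theorem mem_sub_self (φ : Formula P A) : φ ∈ φ.sub := by
  cases φ <;> simp [sub]

theorem finite_sub (φ : Formula P A) : φ.sub.Finite := by
  induction φ with
  | bot | top | atom | natom => exact Set.finite_singleton _
  | and _ _ h₁ h₂ | or _ _ h₁ h₂ => exact (Set.finite_singleton _).union (h₁.union h₂)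
  | box _ _ h | dia _ _ h => exact (Set.finite_singleton _).union h

theorem sub_trans {φ χ : Formula P A} (h : χ ∈ φ.sub) : χ.sub ⊆ φ.sub := by
  induction φ with
  | bot | top | atom | natom =>
    obtain rfl : χ = _ := h
    exact subset_rfl
  | and _ _ h₁ h₂ | or _ _ h₁ h₂ =>
    rcases h with h | h | h
    · obtain rfl : χ = _ := h
      exact subset_rfl
    · exact (h₁ h).trans fun _ hx => Or.inr (Or.inl hx)
    · exact (h₂ h).trans fun _ hx => Or.inr (Or.inr hx)
  | box _ _ ih | dia _ _ ih =>
    rcases h with h | h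
    · obtain rfl : χ = _ := h
      exact subset_rfl
    · exact (ih h).trans fun _ hx => Or.inr hx

theorem posVar_subset_of_mem_sub {φ χ : Formula P A} (h : χ ∈ φ.sub) :
    χ.posVar ⊆ φ.posVar := by
  induction φ with
  | bot | top | atom | natom =>
    obtain rfl : χ = _ := h
    exact subset_rfl
  | and _ _ h₁ h₂ | or _ _ h₁ h₂ =>
    rcases h with h | h | h
    · obtain rfl : χ = _ := h
      exact subset_rfl
    · exact (h₁ h).trans Set.subset_union_left
    · exact (h₂ h).trans Set.subset_union_right
  | box _ _ ih | dia _ _ ih =>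
    rcases h with h | h
    · obtain rfl : χ = _ := h
      exact subset_rfl
    · exact ih h

theorem negVar_subset_of_mem_sub {φ χ : Formula P A} (h : χ ∈ φ.sub) :
    χ.negVar ⊆ φ.negVar := by
  induction φ with
  | bot | top | atom | natom =>
    obtain rfl : χ = _ := h
    exact subset_rfl
  | and _ _ h₁ h₂ | or _ _ h₁ h₂ =>
    rcases h with h | h | h
    · obtain rfl : χ = _ := h
      exact subset_rfl
    · exact (h₁ h).trans Set.subset_union_left
    · exact (h₂ h).trans Set.subset_union_right
  | box _ _ ih | dia _ _ ih =>
    rcases h with h | h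
    · obtain rfl : χ = _ := h
      exact subset_rfl
    · exact ih h

theorem ag_subset_of_mem_sub {φ χ : Formula P A} (h : χ ∈ φ.sub) : χ.ag ⊆ φ.ag := by
  induction φ with
  | bot | top | atom | natom =>
    obtain rfl : χ = _ := h
    exact subset_rfl
  | and _ _ h₁ h₂ | or _ _ h₁ h₂ =>
    rcases h with h | h | h
    · obtain rfl : χ = _ := h
      exact subset_rfl
    · exact (h₁ h).trans Set.subset_union_left
    · exact (h₂ h).trans Set.subset_union_right
  | box _ _ ih | dia _ _ ih =>
    rcases h with h | h
    · obtain rfl : χ = _ := h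
      exact subset_rfl
    · exact (ih h).trans Set.subset_union_right

theorem posVar_neg (φ : Formula P A) : φ.neg.posVar = φ.negVar := by
  induction φ <;> simp_all [neg, posVar, negVar]

theorem negVar_neg (φ : Formula P A) : φ.neg.negVar = φ.posVar := by
  induction φ <;> simp_all [neg, posVar, negVar]

theorem ag_neg (φ : Formula P A) : φ.neg.ag = φ.ag := by
  induction φ <;> simp_all [neg, ag]

end Formula

open Formula

variable {P : Type u} {A : Type v}

theorem Model.sat_neg (M : Model.{u, v, w} P A) (φ : Formula P A) (x : M.World) :
    M.Sat x φ.neg ↔ ¬ M.Sat x φ := by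
  induction φ generalizing x <;> simp_all [neg, Model.Sat, imp_iff_not_or]

theorem Model.sat_imp (M : Model.{u, v, w} P A) (φ ψ : Formula P A) (x : M.World) :
    M.Sat x (φ.imp ψ) ↔ (M.Sat x φ → M.Sat x ψ) := by
  rw [imp_iff_not_or, ← M.sat_neg]
  rfl

/-! ### Types and their separation -/

/-- The set of subformulas of `φ` that are true at a world. -/
def Model.type (M : Model.{u, v, w} P A) (φ : Formula P A) (x : M.World) : Set (Formula P A) :=
  {χ | χ ∈ φ.sub ∧ M.Sat x χ}

/-- The formulas in the language shared by `φ` and the negation of `θ`. -/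
def shared (φ θ : Formula P A) : Set (Formula P A) :=
  {δ | δ.posVar ⊆ φ.posVar ∩ θ.negVar ∧ δ.negVar ⊆ φ.negVar ∩ θ.posVar ∧ δ.ag ⊆ φ.ag ∩ θ.ag}

/-- Some formula of the shared language is true wherever the subformulas of `φ` have a type in
`X` and false wherever the subformulas of `θ` have a type in `Y`. -/
def Separated (φ θ : Formula P A) (X Y : Set (Set (Formula P A))) : Prop :=
  ∃ δ ∈ shared φ θ, ∀ (M : Model.{u, v, w} P A) (x : M.World),
    (M.type φ x ∈ X → M.Sat x δ) ∧ (M.type θ x ∈ Y → ¬ M.Sat x δ)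

/-- Negating the separator exchanges the two sides and its polarities, matching the crossed
polarities in `shared`. -/
theorem Separated.symm {φ θ : Formula P A} {X Y : Set (Set (Formula P A))}
    (h : Separated.{u, v, w} φ θ X Y) : Separated.{u, v, w} θ φ Y X := by
  obtain ⟨δ, ⟨h₁, h₂, h₃⟩, hδ⟩ := h
  refine ⟨δ.neg, ⟨?_, ?_, ?_⟩, fun M x => ?_⟩
  · rwa [posVar_neg, Set.inter_comm]
  · rwa [negVar_neg, Set.inter_comm]
  · rwa [ag_neg, Set.inter_comm]
  · rw [M.sat_neg, not_not]
    exact (hδ M x).symm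

theorem separated_of_forall_left {φ θ : Formula P A} {X Y : Set (Set (Formula P A))}
    (hX : X.Finite) (h : ∀ S ∈ X, Separated.{u, v, w} φ θ {S} Y) :
    Separated.{u, v, w} φ θ X Y := by
  induction X, hX using Set.Finite.induction_on with
  | empty =>
    exact ⟨bot, by simp [shared, posVar, negVar, ag], fun M x => by simp [Model.Sat]⟩
  | @insert S X _ _ ih =>
    obtain ⟨δ, ⟨p, n, g⟩, hδ⟩ := ih fun S hS => h S (Or.inr hS)
    obtain ⟨δ', ⟨p', n', g'⟩, hδ'⟩ := h S (Or.inl rfl)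
    refine ⟨or δ δ', ⟨Set.union_subset p p', Set.union_subset n n', Set.union_subset g g'⟩,
      fun M x => ⟨?_, fun hY => ?_⟩⟩
    · rintro (hx | hx)
      · exact Or.inr ((hδ' M x).1 hx)
      · exact Or.inl ((hδ M x).1 hx)
    · rintro (hx | hx)
      · exact (hδ M x).2 hY hx
      · exact (hδ' M x).2 hY hx

/-- The separator is a finite Boolean combination: disjunctions handle the left side, and by
symmetry conjunctions handle the right. -/
theorem separated_of_forall {φ θ : Formula P A} {X Y : Set (Set (Formula P A))}
    (hX : X.Finite) (hY : Y.Finite)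
    (h : ∀ S ∈ X, ∀ T ∈ Y, Separated.{u, v, w} φ θ {S} {T}) : Separated.{u, v, w} φ θ X Y :=
  separated_of_forall_left hX fun S hS =>
    (separated_of_forall_left hY fun T hT => (h S hS T hT).symm).symm

/-- Two types contain the same boxed and diamond formulas of the agent `a`. -/
def ModalEq (a : A) (S T : Set (Formula P A)) : Prop :=
  ∀ χ, (box a χ ∈ S ↔ box a χ ∈ T) ∧ (dia a χ ∈ S ↔ dia a χ ∈ T)

theorem modalEq_equivalence (a : A) : Equivalence (ModalEq (P := P) a) where
  refl _ _ := ⟨Iff.rfl, Iff.rfl⟩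
  symm h χ := ⟨(h χ).1.symm, (h χ).2.symm⟩
  trans h h' χ := ⟨(h χ).1.trans (h' χ).1, (h χ).2.trans (h' χ).2⟩

/-- Related worlds have the same `a`-successors, by symmetry and transitivity. -/
theorem Model.modalEq_type (M : Model.{u, v, w} P A) (φ : Formula P A) {a : A} {x y : M.World}
    (h : M.R a x y) : ModalEq a (M.type φ x) (M.type φ y) := fun _ =>
  ⟨and_congr_right fun _ =>
    ⟨fun H z hz => H z ((M.equiv a).trans h hz),
      fun H z hz => H z ((M.equiv a).trans ((M.equiv a).symm h) hz)⟩,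
   and_congr_right fun _ =>
    ⟨fun ⟨z, hz, H⟩ => ⟨z, (M.equiv a).trans ((M.equiv a).symm h) hz, H⟩,
      fun ⟨z, hz, H⟩ => ⟨z, (M.equiv a).trans h hz, H⟩⟩⟩

theorem modalEq_of_notMem_ag {θ : Formula P A} {a : A} (ha : a ∉ θ.ag)
    {S T : Set (Formula P A)} (hS : S ⊆ θ.sub) (hT : T ⊆ θ.sub) : ModalEq a S T := by
  have hb (χ : Formula P A) : box a χ ∉ θ.sub := fun h => ha (ag_subset_of_mem_sub h (Or.inl rfl))
  have hd (χ : Formula P A) : dia a χ ∉ θ.sub := fun h => ha (ag_subset_of_mem_sub h (Or.inl rfl))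
  exact fun χ => ⟨iff_of_false (fun h => hb χ (hS h)) (fun h => hb χ (hT h)),
    iff_of_false (fun h => hd χ (hS h)) (fun h => hd χ (hT h))⟩

/-! ### Inseparable pairs -/

/-- A pair of types that the shared language does not separate. -/
def Inseparable (φ θ : Formula P A) (S T : Set (Formula P A)) : Prop :=
  S ⊆ φ.sub ∧ T ⊆ θ.sub ∧ ¬ Separated.{u, v, w} φ θ {S} {T}

theorem Inseparable.symm {φ θ : Formula P A} {S T : Set (Formula P A)}
    (h : Inseparable.{u, v, w} φ θ S T) : Inseparable.{u, v, w} θ φ T S :=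
  ⟨h.2.1, h.1, fun hs => h.2.2 hs.symm⟩

/-- An unrealized type is separated from anything by `⊥`. -/
theorem Inseparable.exists_type_eq {φ θ : Formula P A} {S T : Set (Formula P A)}
    (h : Inseparable.{u, v, w} φ θ S T) :
    ∃ (M : Model.{u, v, w} P A) (x : M.World), M.type φ x = S := by
  by_contra! hn
  exact h.2.2 ⟨bot, by simp [shared, posVar, negVar, ag],
    fun M x => ⟨fun hx => (hn M x hx).elim, fun _ => id⟩⟩

/-- The literal `¬p` would itself separate; its polarity is the shared one, which gives the Lyndon
condition. -/
theorem Inseparable.atom_notMem {φ θ : Formula P A} {S T : Set (Formula P A)}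
    (h : Inseparable.{u, v, w} φ θ S T) {p : P} (hS : natom p ∈ S) : atom p ∉ T := by
  intro hT
  have hn : p ∈ φ.negVar := negVar_subset_of_mem_sub (h.1 hS) rfl
  have hp : p ∈ θ.posVar := posVar_subset_of_mem_sub (h.2.1 hT) rfl
  refine h.2.2 ⟨natom p, ⟨Set.empty_subset _, ?_, Set.empty_subset _⟩, fun M x => ⟨?_, ?_⟩⟩
  · exact Set.singleton_subset_iff.2 ⟨hn, hp⟩
  · rintro rfl
    exact hS.2
  · rintro rfl hx
    exact hx hT.2

/-- Without a witness pair, all candidate successor types are separated by a single `δ`, and then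
`◇_a δ` separates `S` from `T`, provided that `a` is a shared agent. -/
theorem Inseparable.exists_of_dia_mem {φ θ : Formula P A} {S T : Set (Formula P A)}
    (h : Inseparable.{u, v, w} φ θ S T) {a : A} {χ : Formula P A} (hχ : dia a χ ∈ S) :
    ∃ S' T', Inseparable.{u, v, w} φ θ S' T' ∧ ModalEq a S S' ∧ ModalEq a T T' ∧ χ ∈ S' := by
  by_contra! hn
  have haφ : a ∈ φ.ag := ag_subset_of_mem_sub (h.1 hχ) (Or.inl rfl)
  have hχφ : χ ∈ φ.sub := sub_trans (h.1 hχ) (Or.inr (mem_sub_self χ))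
  obtain ⟨δ, ⟨hp, hg, ha⟩, hδ⟩ : Separated.{u, v, w} φ θ
      {S' | S' ⊆ φ.sub ∧ ModalEq a S S' ∧ χ ∈ S'} {T' | T' ⊆ θ.sub ∧ ModalEq a T T'} := by
    refine separated_of_forall (φ.finite_sub.finite_subsets.subset fun _ => And.left)
      (θ.finite_sub.finite_subsets.subset fun _ => And.left) fun S' hS' T' hT' => ?_
    by_contra hs
    exact hn S' T' ⟨hS'.1, hT'.1, hs⟩ hS'.2.1 hT'.2 hS'.2.2
  have key (M : Model.{u, v, w} P A) (x : M.World) (hx : M.type φ x ∈ ({S} : Set _)) :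
      ∃ y, M.R a x y ∧ M.Sat y δ := by
    obtain rfl : M.type φ x = S := hx
    obtain ⟨y, hxy, hy⟩ := hχ.2
    exact ⟨y, hxy, (hδ M y).1 ⟨fun _ => And.left, M.modalEq_type φ hxy, hχφ, hy⟩⟩
  by_cases haθ : a ∈ θ.ag
  · refine h.2.2 ⟨dia a δ, ⟨hp, hg, ?_⟩, fun M x => ⟨key M x, ?_⟩⟩
    · exact Set.union_subset (Set.singleton_subset_iff.2 ⟨haφ, haθ⟩) ha
    · rintro rfl ⟨y, hxy, hy⟩
      exact (hδ M y).2 ⟨fun _ => And.left, M.modalEq_type θ hxy⟩ hy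
  -- Since `a` does not occur in `θ`, every `θ`-type agrees with `T` on `a`, so `δ` is false
  -- everywhere. Hence `S` is unrealizable and `⊥` separates.
  · refine h.2.2 ⟨bot, by simp [shared, posVar, negVar, ag], fun M x => ⟨fun hx => ?_, fun _ => id⟩⟩
    obtain ⟨y, -, hy⟩ := key M x hx
    exact (hδ M y).2 ⟨fun _ => And.left,
      modalEq_of_notMem_ag haθ h.2.1 fun _ => And.left⟩ hy

/-! ### The model of inseparable pairs -/

/-- A model labelled by realizable types, with enough witnesses, satisfies its labels. -/
theorem Model.sat_of_mem_label (K : Model.{u, v, w} P A) (φ : Formula P A)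
    (t : K.World → Set (Formula P A))
    (real : ∀ x, ∃ (M : Model.{u, v, w} P A) (y : M.World), M.type φ y = t x)
    (pos : ∀ x p, atom p ∈ t x → x ∈ K.V p) (neg : ∀ x p, natom p ∈ t x → x ∉ K.V p)
    (rel : ∀ a x y, K.R a x y → ModalEq a (t x) (t y))
    (wit : ∀ a x χ, dia a χ ∈ t x → ∃ y, K.R a x y ∧ χ ∈ t y)
    {χ : Formula P A} {x : K.World} (h : χ ∈ t x) : K.Sat x χ := by
  have down {x χ ξ} (hχ : χ ∈ t x) (hξ : ξ ∈ χ.sub)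
      (hs : ∀ (M : Model.{u, v, w} P A) (y : M.World), M.Sat y χ → M.Sat y ξ) : ξ ∈ t x := by
    obtain ⟨M, y, hy⟩ := real x
    rw [← hy] at hχ ⊢
    exact ⟨sub_trans hχ.1 hξ, hs M y hχ.2⟩
  induction χ generalizing x with
  | bot =>
    obtain ⟨M, y, hy⟩ := real x
    rw [← hy] at h
    exact h.2
  | top => trivial
  | atom p => exact pos x p h
  | natom p => exact neg x p h
  | and α β hα hβ =>
    exact ⟨hα (down h (Or.inr (Or.inl α.mem_sub_self)) fun _ _ => And.left),
      hβ (down h (Or.inr (Or.inr β.mem_sub_self)) fun _ _ => And.right)⟩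
  | or α β hα hβ =>
    obtain ⟨M, y, hy⟩ := real x
    have h' := h
    rw [← hy] at h'
    rcases h'.2 with hs | hs
    · refine Or.inl (hα ?_)
      rw [← hy]
      exact ⟨sub_trans h'.1 (Or.inr (Or.inl α.mem_sub_self)), hs⟩
    · refine Or.inr (hβ ?_)
      rw [← hy]
      exact ⟨sub_trans h'.1 (Or.inr (Or.inr β.mem_sub_self)), hs⟩
  -- The box is transferred to the label of `y`; reflexivity in a model realizing that label then
  -- gives `α`.
  | box a α ih =>
    exact fun y hy => ih (down (((rel a x y hy) α).1.1 h) (Or.inr α.mem_sub_self)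
      fun M z hz => hz z ((M.equiv a).refl z))
  | dia a α ih =>
    obtain ⟨y, hy, hα⟩ := wit a x α h
    exact ⟨y, hy, ih hα⟩

/-- An inseparable pair of types is realized in a single world. -/
theorem Inseparable.exists_model {φ θ : Formula P A} {S T : Set (Formula P A)}
    (h : Inseparable.{u, v, w} φ θ S T) :
    ∃ (K : Model.{u, v, w} P A) (x : K.World),
      (∀ χ ∈ S, K.Sat x χ) ∧ (∀ χ ∈ T, K.Sat x χ) := by
  let W := {q : Set (Formula P A) × Set (Formula P A) // Inseparable.{u, v, w} φ θ q.1 q.2}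
  have : Finite W := Set.Finite.to_subtype
    ((φ.finite_sub.finite_subsets.prod θ.finite_sub.finite_subsets).subset
      fun _ hq => ⟨hq.1, hq.2.1⟩)
  -- Finiteness allows the worlds to be moved into the universe `w`.
  let e : W ≃ Shrink.{w} W := equivShrink.{w} W
  let l (x : Shrink.{w} W) : Set (Formula P A) := (e.symm x).1.1
  let r (x : Shrink.{w} W) : Set (Formula P A) := (e.symm x).1.2
  have hlr (x) : Inseparable.{u, v, w} φ θ (l x) (r x) := (e.symm x).2
  have surj {S' T'} (h' : Inseparable.{u, v, w} φ θ S' T') : ∃ x, l x = S' ∧ r x = T' :=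
    ⟨e ⟨(S', T'), h'⟩, by simp [l], by simp [r]⟩
  obtain ⟨x₀, rfl, rfl⟩ := surj h
  have clash {φ θ : Formula P A} {S T : Set (Formula P A)}
      (h : Inseparable.{u, v, w} φ θ S T) {p : P} (hS : natom p ∈ S) : atom p ∉ S := by
    obtain ⟨M, y, rfl⟩ := h.exists_type_eq
    exact fun hp => hS.2 hp.2
  let K : Model.{u, v, w} P A :=
    { World := Shrink.{w} W
      nonempty := ⟨x₀⟩
      R := fun a x y => ModalEq a (l x) (l y) ∧ ModalEq a (r x) (r y)
      equiv := fun a =>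
        { refl := fun _ => ⟨(modalEq_equivalence a).refl _, (modalEq_equivalence a).refl _⟩
          symm := fun h => ⟨(modalEq_equivalence a).symm h.1, (modalEq_equivalence a).symm h.2⟩
          trans := fun h h' => ⟨(modalEq_equivalence a).trans h.1 h'.1,
            (modalEq_equivalence a).trans h.2 h'.2⟩ }
      -- An atom is true as soon as either label demands it; a negative literal then requires its
      -- absence from both labels.
      V := fun p => {x | atom p ∈ l x ∨ atom p ∈ r x} }
  refine ⟨K, x₀, fun χ => ?_, fun χ => ?_⟩
  · refine K.sat_of_mem_label φ l (fun x => (hlr x).exists_type_eq) (fun x p => Or.inl)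
      (fun x p hp => ?_) (fun a x y => And.left) (fun a x χ hχ => ?_)
    · rintro (hq | hq)
      · exact clash (hlr x) hp hq
      · exact (hlr x).atom_notMem hp hq
    · obtain ⟨S', T', h', hS, hT, hmem⟩ := (hlr x).exists_of_dia_mem hχ
      obtain ⟨y, rfl, rfl⟩ := surj h'
      exact ⟨y, ⟨hS, hT⟩, hmem⟩
  · refine K.sat_of_mem_label θ r (fun x => (hlr x).symm.exists_type_eq) (fun x p => Or.inr)
      (fun x p hp => ?_) (fun a x y => And.right) (fun a x χ hχ => ?_)
    · rintro (hq | hq)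
      · exact (hlr x).symm.atom_notMem hp hq
      · exact clash (hlr x).symm hp hq
    · obtain ⟨T', S', h', hT, hS, hmem⟩ := (hlr x).symm.exists_of_dia_mem hχ
      obtain ⟨y, rfl, rfl⟩ := surj h'.symm
      exact ⟨y, ⟨hS, hT⟩, hmem⟩

/-! ### Interpolation -/

theorem hasALIP_S5 (P : Type u) (A : Type v) : HasALIP (S5.{u, v, w} P A) := by
  intro φ ψ hφψ
  obtain ⟨δ, ⟨hp, hn, ha⟩, hδ⟩ : Separated.{u, v, w} φ ψ.neg
      {S | S ⊆ φ.sub ∧ φ ∈ S} {T | T ⊆ ψ.neg.sub ∧ ψ.neg ∈ T} := by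
    refine separated_of_forall (φ.finite_sub.finite_subsets.subset fun _ => And.left)
      (ψ.neg.finite_sub.finite_subsets.subset fun _ => And.left) fun S hS T hT => ?_
    by_contra hs
    obtain ⟨K, x, hKS, hKT⟩ := Inseparable.exists_model ⟨hS.1, hT.1, hs⟩
    exact (K.sat_neg ψ x).1 (hKT _ hT.2) ((K.sat_imp φ ψ x).1 (hφψ K x) (hKS _ hS.2))
  refine ⟨δ, fun M x => (M.sat_imp _ _ x).2 fun hφ => ?_,
    fun M x => (M.sat_imp _ _ x).2 fun hx => ?_, ?_, ?_, ?_⟩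
  · exact (hδ M x).1 ⟨fun _ => And.left, φ.mem_sub_self, hφ⟩
  · by_contra hψ
    exact (hδ M x).2 ⟨fun _ => And.left, ψ.neg.mem_sub_self, (M.sat_neg ψ x).2 hψ⟩ hx
  · rwa [negVar_neg] at hp
  · rwa [posVar_neg] at hn
  · rwa [ag_neg] at ha

section Consequences

variable {L : Set (Formula P A)}

theorem HasALIP.hasLIP (h : HasALIP L) : HasLIP L := fun φ ψ hφψ =>
  let ⟨δ, h₁, h₂, hp, hn, _⟩ := h φ ψ hφψ
  ⟨δ, h₁, h₂, hp, hn⟩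

theorem HasALIP.hasAgentCIP (h : HasALIP L) : HasAgentCIP L := fun φ ψ hφψ =>
  let ⟨δ, h₁, h₂, hp, hn, ha⟩ := h φ ψ hφψ
  ⟨δ, h₁, h₂, Set.union_subset
    (hp.trans (Set.inter_subset_inter Set.subset_union_left Set.subset_union_left))
    (hn.trans (Set.inter_subset_inter Set.subset_union_right Set.subset_union_right)), ha⟩

theorem HasAgentCIP.hasCIP (h : HasAgentCIP L) : HasCIP L := fun φ ψ hφψ =>
  let ⟨δ, h₁, h₂, hv, _⟩ := h φ ψ hφψ
  ⟨δ, h₁, h₂, hv⟩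

end Consequences

end EpistemicLogic

theorem mainTheorem5 (P : Type u) (A : Type v) [Countable P] [Infinite P]
    [Finite A] [Nonempty A] :
    EpistemicLogic.HasALIP (EpistemicLogic.S5.{u, v, w} P A) ∧
    EpistemicLogic.HasLIP (EpistemicLogic.S5.{u, v, w} P A) ∧
    EpistemicLogic.HasAgentCIP (EpistemicLogic.S5.{u, v, w} P A) ∧
    EpistemicLogic.HasCIP (EpistemicLogic.S5.{u, v, w} P A) :=
  have h := EpistemicLogic.hasALIP_S5.{u, v, w} P A
  ⟨h, h.hasLIP, h.hasAgentCIP, h.hasAgentCIP.hasCIP⟩
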